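/- A map of simplicial sets is an inner fibration if it has the right lifting property with respect to every inner horn inclusion $\Lambda^n_k\subset\Delta^n$ with $0<k<n$, and a map of simplicial sets is inner anodyne if it has the left lifting property with respect to every inner fibration (every inner anodyne map is a monomorphism). The class of inner anodyne maps has the right cancellation property: for all monomorphisms of simplicial sets $i\colon A\to B$ and $j\colon B\to C$, if $i$ and the composite $ji$ are inner anodyne, then $j$ is inner anodyne. -/

import Mathlib

open CategoryTheory MorphismProperty Simplicial

universe u

/-- The right cancellation property, for a class `𝒜` of monomorphisms of simplicial sets:
for all monomorphisms `i : A ⟶ B` and `j : B ⟶ C`, if `i` and `j ∘ i` (which is `i ≫ j` in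
diagrammatic order) belong to `𝒜`, then so does `j`. -/
def SSet.RightCancellation (𝒜 : MorphismProperty SSet.{u}) : Prop :=
  ∀ ⦃A B C : SSet.{u}⦄ (i : A ⟶ B) (j : B ⟶ C), Mono i → Mono j →
    𝒜 i → 𝒜 (i ≫ j) → 𝒜 j

/-- Inner anodyne maps, i.e. the maps with the left lifting property with respect to all inner
fibrations, form a class of monomorphisms, so that the right cancellation property makes sense
for this class. -/
theorem SSet.innerAnodyneExtensions_le_monomorphisms :
    SSet.innerAnodyneExtensions.{u} ≤ monomorphisms SSet.{u} := by
  have h : (coproducts.{u} SSet.innerHornInclusions.{u}).pushouts ≤ monomorphisms SSet.{u} := by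
    rw [pushouts_le_iff, coproducts_le_iff]
    exact SSet.innerHornInclusions_le_monomorphisms
  rw [SSet.innerAnodyneExtensions_eq_retracts_transfiniteCompositionsOfShape, retracts_le_iff]
  exact (transfiniteCompositionsOfShape_monotone ℕ h).trans
    (transfiniteCompositionsOfShape_le _ ℕ)

/-! Let `p : X ⟶ Y` be an inner fibration, and take a square from `j` to `p` with top `f : B ⟶ X`.
As `ji` is inner anodyne, there is `t : C ⟶ X` solving the problem on `A`; it may differ from `f` on
`B`. Both `tj` and `f` extend the same map on `A` and have the same image in `Y`, so, `i` being
inner anodyne, they are joined by a homotopy over `Y` parametrized by `coherentIso`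
(`exists_homotopy`). If this homotopy extends to `C`, starting from `t` and over `Y`
(`exists_extension`), its other end is the required lift.

The extension needs lifts against the pushout products of an endpoint of `coherentIso` with `∂Δ[n] ⟶
Δ[n]`. For `n = 0` these need not exist, but the constant homotopy at `t` supplies what is missing
on vertices. For `n ≠ 0` the pushout product is inner anodyne, by a regular inner pairing
(`pairingCore`). A simplex of `coherentIso ⊗ Δ[n]` is a walk: arbitrary labels in `Bool` and
monotone positions. The missing nondegenerate simplices are the reduced walks that visit every
position and some label `true`. Each has exactly one gap or exactly one plug; filling the gap,
always by a vertex labelled `false`, pairs the former with the latter. -/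

namespace SSet.isoCylinder

/-- A walk is given by the labels `e` and the positions `a` of its vertices. It has a gap at `k` if
either `k` is the last vertex over `0` and its label is `true`, or `k + 1` is the first vertex
with label `true` and its position differs from that of `k`. -/
def HasGap {m n : ℕ} (e : Fin (m + 1) → Bool) (a : Fin (m + 1) → Fin (n + 1)) (k : Fin m) : Prop :=
  (a k.castSucc = 0 ∧ a k.succ ≠ 0 ∧ e k.castSucc = true) ∨
    ((∀ l ≤ k.castSucc, e l = false) ∧ e k.succ = true ∧ a k.castSucc ≠ a k.succ)

/-- The vertex `k + 1` of a walk, with label `false`, is a plug if it fills the gap at `k` of the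
walk obtained by deleting it. -/
def HasPlug {m n : ℕ} (e : Fin (m + 2) → Bool) (a : Fin (m + 2) → Fin (n + 1)) (k : Fin m) : Prop :=
  (a k.succ.castSucc = 0 ∧ a k.succ.succ ≠ 0 ∧ e k.castSucc.castSucc = true ∧
      e k.succ.castSucc = false) ∨
    ((∀ l ≤ k.succ.castSucc, e l = false) ∧ e k.succ.succ = true ∧
      a k.succ.castSucc = a k.succ.succ ∧ a k.succ.castSucc ≠ 0)

/-- A walk is reduced if no two consecutive vertices are equal. -/
def Reduced {m n : ℕ} (e : Fin (m + 1) → Bool) (a : Fin (m + 1) → Fin (n + 1)) : Prop :=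
  ∀ k : Fin m, e k.castSucc = e k.succ → a k.castSucc ≠ a k.succ

variable {m n : ℕ}

lemma succAbove_castSucc_self (k : Fin m) :
    k.succ.castSucc.succAbove k.castSucc = k.castSucc.castSucc := by
  ext; simp [Fin.succAbove, Fin.lt_def]

lemma succAbove_succ_self (k : Fin m) :
    k.succ.castSucc.succAbove k.succ = k.succ.succ := by
  ext; simp [Fin.succAbove]

lemma succAbove_of_le (k : Fin m) (l : Fin (m + 1)) (h : l ≤ k.castSucc) :
    k.succ.castSucc.succAbove l = l.castSucc := by
  exact Fin.succAbove_of_castSucc_lt _ _ (by grind)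

/-! ### Gaps and plugs of reduced walks -/

section

variable {e : Fin (m + 1) → Bool} {a : Fin (m + 1) → Fin (n + 1)}

/-- The last vertex over `0` and the first label `true` are unique, so only gaps of different kinds
could coexist. A gap of the second kind needs labels `false` up to it and a change of position, so
it can be neither at or after the first one nor before it. -/
lemma HasGap.unique (ha : Monotone a) {k k' : Fin m}
    (h : HasGap e a k) (h' : HasGap e a k') : k = k' := by
  wlog hk : k ≤ k' generalizing k k'
  · exact (this h' h (le_of_not_ge hk)).symm
  by_contra hne
  have hlt : k.succ ≤ k'.castSucc := by
    rw [Fin.le_def]; simp; omega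
  have h1 := ha hlt
  have h2 : a k'.castSucc ≤ a k'.succ := ha k'.castSucc_le_succ
  have h3 : a k.castSucc ≤ a k.succ := ha k.castSucc_le_succ
  rcases h with ⟨h4, h5, h6⟩ | ⟨h4, h5, h6⟩ <;> rcases h' with ⟨h7, h8, h9⟩ | ⟨h7, h8, h9⟩
  · rw [h7] at h1; exact h5 (Fin.le_zero_iff.1 h1)
  · have := h7 k.castSucc (by rw [Fin.le_def]; simpa using hk); grind
  · rw [h7] at h1
    have h10 := Fin.le_zero_iff.1 h1
    rw [h10] at h3
    exact h6 ((Fin.le_zero_iff.1 h3).trans h10.symm)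
  · have := h7 _ hlt; grind

end

section

variable {e : Fin (m + 2) → Bool} {a : Fin (m + 2) → Fin (n + 1)}

lemma HasPlug.apply_eq_false {k : Fin m} (h : HasPlug e a k) : e k.succ.castSucc = false := by
  rcases h with h | h
  · exact h.2.2.2
  · exact h.1 _ le_rfl

lemma HasPlug.hasGap (he : Reduced e a) (ha : Monotone a) {k : Fin m} (h : HasPlug e a k) :
    HasGap (e ∘ k.succ.castSucc.succAbove) (a ∘ k.succ.castSucc.succAbove) k := by
  simp only [HasGap, Function.comp_apply, succAbove_castSucc_self, succAbove_succ_self]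
  rcases h with ⟨h1, h2, h3, h4⟩ | ⟨h1, h2, h3, h4⟩
  · refine .inl ⟨?_, h2, h3⟩
    have := ha (show k.castSucc.castSucc ≤ k.succ.castSucc by simp [Fin.le_def])
    rw [h1] at this
    exact Fin.le_zero_iff.1 this
  · refine .inr ⟨fun l hl ↦ ?_, h2, ?_⟩
    · rw [succAbove_of_le _ _ hl]
      exact h1 _ (by grind)
    · rw [← h3]
      exact he k.castSucc ((h1 _ (by simp [Fin.le_def])).trans (h1 _ le_rfl).symm)

lemma HasPlug.apply_eq {k : Fin m} (h : HasPlug e a k) :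
    a k.succ.castSucc = if e k.castSucc.castSucc then 0 else a k.succ.succ := by
  rcases h with ⟨h1, h2, h3, h4⟩ | ⟨h1, h2, h3, h4⟩
  · rw [h1, h3, if_pos rfl]
  · rw [if_neg (by simp [h1 k.castSucc.castSucc (by simp [Fin.le_def])]), h3]

/-- This keeps the two types of simplices of the pairing disjoint. -/
lemma HasPlug.not_hasGap (ha : Monotone a) {k : Fin m} (h : HasPlug e a k) (k' : Fin (m + 1)) :
    ¬ HasGap e a k' := by
  intro h'
  have h0 : a k'.castSucc ≤ a k'.succ := ha k'.castSucc_le_succ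
  rcases h with ⟨h1, h2, h3, h4⟩ | ⟨h1, h2, h3, h4⟩ <;> rcases h' with ⟨h7, h8, h9⟩ | ⟨h7, h8, h9⟩
  · rcases lt_trichotomy k' k.succ with hk | rfl | hk
    · have := ha (show k'.succ ≤ k.succ.castSucc by grind)
      grind [Fin.le_zero_iff]
    · grind
    · have := ha (show k.succ.succ ≤ k'.castSucc by grind)
      grind [Fin.le_zero_iff]
  · by_cases hk : k.castSucc ≤ k'
    · have := h7 k.castSucc.castSucc (by simpa [Fin.le_def] using hk)
      grind
    · have := ha (show k'.succ ≤ k.succ.castSucc by grind)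
      grind [Fin.le_zero_iff]
  · by_cases hk : k'.castSucc ≤ k.succ.castSucc
    · grind
    · have := ha (show k.succ.castSucc ≤ k'.castSucc by grind)
      grind [Fin.le_zero_iff]
  · rcases lt_trichotomy k' k.succ with hk | rfl | hk
    · have := h1 k'.succ (by grind)
      grind
    · grind
    · have := h7 k.succ.succ (by grind)
      grind

lemma HasPlug.unique (ha : Monotone a) {k k' : Fin m}
    (h : HasPlug e a k) (h' : HasPlug e a k') : k = k' := by
  wlog hk : k ≤ k' generalizing k k'
  · exact (this h' h (le_of_not_ge hk)).symm
  by_contra hne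
  have hlt : k.succ.succ ≤ k'.succ.castSucc := by grind
  have h1 := ha hlt
  rcases h with ⟨h4, h5, h6, h10⟩ | ⟨h4, h5, h6, h10⟩ <;>
    rcases h' with ⟨h7, h8, h9, h11⟩ | ⟨h7, h8, h9, h11⟩
  · grind [Fin.le_zero_iff]
  · have := h7 k.castSucc.castSucc (by grind)
    grind
  · grind [Fin.le_zero_iff]
  · have := h7 _ hlt; grind

end

section

variable {e : Fin (m + 2) → Bool} {a : Fin (m + 2) → Fin (n + 1)}

lemma HasPlug.reduced_comp (he : Reduced e a) (ha : Monotone a) {k : Fin m} (h : HasPlug e a k) :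
    Reduced (e ∘ k.succ.castSucc.succAbove) (a ∘ k.succ.castSucc.succAbove) := by
  intro l
  obtain hl | rfl | hl := lt_trichotomy l k
  · simp only [Function.comp_apply]
    rw [Fin.succAbove_of_castSucc_lt _ _ (by grind), Fin.succAbove_of_castSucc_lt _ _ (by grind)]
    exact he l.castSucc
  · simp only [Function.comp_apply, succAbove_castSucc_self, succAbove_succ_self]
    rcases h with ⟨h1, h2, h3, h4⟩ | ⟨h1, h2, h3, h4⟩
    · intro _ h5
      have := ha (show l.castSucc.castSucc ≤ l.succ.castSucc by grind)
      rw [h5, h1] at this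
      exact h2 (Fin.le_zero_iff.1 this)
    · simp [h2, h1 l.castSucc.castSucc (by grind)]
  · simp only [Function.comp_apply]
    rw [Fin.succAbove_of_le_castSucc _ _ (by grind), Fin.succAbove_of_le_castSucc _ _ (by grind)]
    exact he l.succ

lemma HasPlug.surjective_comp (ha : Monotone a) {k : Fin m} (h : HasPlug e a k)
    (ha' : Function.Surjective a) : Function.Surjective (a ∘ k.succ.castSucc.succAbove) := by
  intro i
  obtain ⟨j, rfl⟩ := ha' i
  obtain rfl | ⟨j, rfl⟩ := Fin.eq_self_or_eq_succAbove k.succ.castSucc j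
  · rcases h with ⟨h1, h2, h3, h4⟩ | ⟨h1, h2, h3, h4⟩
    · refine ⟨k.castSucc, ?_⟩
      have := ha (show k.castSucc.castSucc ≤ k.succ.castSucc by grind)
      rw [h1] at this
      rw [Function.comp_apply, succAbove_castSucc_self, h1, Fin.le_zero_iff.1 this]
    · exact ⟨k.succ, by rw [Function.comp_apply, succAbove_succ_self, h3]⟩
  · exact ⟨j, rfl⟩

lemma HasPlug.exists_eq_true {k : Fin m} (h : HasPlug e a k) (he : ∃ l, e l = true) :
    ∃ l, (e ∘ k.succ.castSucc.succAbove) l = true := by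
  obtain ⟨j, hj⟩ := he
  obtain rfl | ⟨j, rfl⟩ := Fin.eq_self_or_eq_succAbove k.succ.castSucc j
  · rw [h.apply_eq_false] at hj
    exact (Bool.false_ne_true hj).elim
  · exact ⟨j, hj⟩

/-- If `i < j`, the entries numbered `i` of the two faces are the vertices `i + 1` and `i`, which
are distinct in a reduced walk. -/
lemma Reduced.succAbove_injective (he : Reduced e a) {i j : Fin (m + 2)}
    (h : e ∘ i.succAbove = e ∘ j.succAbove) (h' : a ∘ i.succAbove = a ∘ j.succAbove) : i = j := by
  wlog hij : i ≤ j generalizing i j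
  · exact (this h.symm h'.symm (le_of_not_ge hij)).symm
  by_contra hne
  obtain ⟨i, rfl⟩ := i.eq_castSucc_of_ne_last (by grind)
  have h1 : i.castSucc.succAbove i = i.succ := Fin.succAbove_castSucc_self i
  have h2 : j.succAbove i = i.castSucc := Fin.succAbove_of_castSucc_lt _ _ (by grind)
  have h3 := congr_fun h i
  have h4 := congr_fun h' i
  simp only [Function.comp_apply, h1, h2] at h3 h4
  exact he i h3.symm h4.symm

end

/-! ### Filling gaps -/

section

variable {e : Fin (m + 1) → Bool} {a : Fin (m + 1) → Fin (n + 1)}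

/-- The labels of the walk obtained by filling the gap `k`. -/
def fillLabel (e : Fin (m + 1) → Bool) (k : Fin m) : Fin (m + 2) → Bool :=
  k.succ.castSucc.insertNth (α := fun _ ↦ Bool) false e

/-- The positions of the walk obtained by filling the gap `k`. -/
def fillPos (e : Fin (m + 1) → Bool) (a : Fin (m + 1) → Fin (n + 1)) (k : Fin m) :
    Fin (m + 2) → Fin (n + 1) :=
  k.succ.castSucc.insertNth (α := fun _ ↦ Fin (n + 1))
    (if e k.castSucc then a k.castSucc else a k.succ) a

lemma fillLabel_comp (e : Fin (m + 1) → Bool) (k : Fin m) :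
    fillLabel e k ∘ k.succ.castSucc.succAbove = e := by
  ext; simp [fillLabel]

lemma fillPos_comp (e : Fin (m + 1) → Bool) (a : Fin (m + 1) → Fin (n + 1)) (k : Fin m) :
    fillPos e a k ∘ k.succ.castSucc.succAbove = a := by
  ext; simp [fillPos]

lemma fillLabel_self (e : Fin (m + 1) → Bool) (k : Fin m) :
    fillLabel e k k.succ.castSucc = false := by
  simp [fillLabel]

lemma fillLabel_castSucc (e : Fin (m + 1) → Bool) (k : Fin m) :
    fillLabel e k k.castSucc.castSucc = e k.castSucc := by
  simpa only [succAbove_castSucc_self, Function.comp_apply] using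
    congr_fun (fillLabel_comp e k) k.castSucc

lemma fillLabel_succ (e : Fin (m + 1) → Bool) (k : Fin m) :
    fillLabel e k k.succ.succ = e k.succ := by
  simpa only [succAbove_succ_self, Function.comp_apply] using
    congr_fun (fillLabel_comp e k) k.succ

lemma fillPos_self (e : Fin (m + 1) → Bool) (a : Fin (m + 1) → Fin (n + 1)) (k : Fin m) :
    fillPos e a k k.succ.castSucc = if e k.castSucc then a k.castSucc else a k.succ := by
  simp [fillPos]

lemma fillPos_castSucc (e : Fin (m + 1) → Bool) (a : Fin (m + 1) → Fin (n + 1)) (k : Fin m) :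
    fillPos e a k k.castSucc.castSucc = a k.castSucc := by
  simpa only [succAbove_castSucc_self, Function.comp_apply] using
    congr_fun (fillPos_comp e a k) k.castSucc

lemma fillPos_succ (e : Fin (m + 1) → Bool) (a : Fin (m + 1) → Fin (n + 1)) (k : Fin m) :
    fillPos e a k k.succ.succ = a k.succ := by
  simpa only [succAbove_succ_self, Function.comp_apply] using
    congr_fun (fillPos_comp e a k) k.succ

lemma monotone_fillPos (ha : Monotone a) (k : Fin m) : Monotone (fillPos e a k) := by
  have h : a k.castSucc ≤ a k.succ := ha k.castSucc_le_succ
  have h1 := fillPos_self e a k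
  have h2 (l : Fin (m + 1)) : fillPos e a k (k.succ.castSucc.succAbove l) = a l :=
    congr_fun (fillPos_comp e a k) l
  intro i j hij
  obtain rfl | ⟨i, rfl⟩ := Fin.eq_self_or_eq_succAbove k.succ.castSucc i <;>
    obtain rfl | ⟨j, rfl⟩ := Fin.eq_self_or_eq_succAbove k.succ.castSucc j
  · exact le_rfl
  · rw [h1, h2]
    have : k.succ ≤ j := by
      by_contra! hj
      rw [Fin.succAbove_of_castSucc_lt _ _ (by grind)] at hij
      grind
    exact le_trans (by grind) (ha this)
  · rw [h1, h2]
    have : i ≤ k.castSucc := by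
      by_contra! hj
      rw [Fin.succAbove_of_le_castSucc _ _ (by grind)] at hij
      grind
    exact le_trans (ha this) (by grind)
  · rw [h2, h2]
    exact ha ((Fin.strictMono_succAbove _).le_iff_le.1 hij)

lemma HasGap.hasPlug (ha : Monotone a) {k : Fin m} (h : HasGap e a k) :
    HasPlug (fillLabel e k) (fillPos e a k) k := by
  simp only [HasPlug, fillLabel_castSucc, fillLabel_succ, fillLabel_self, fillPos_self,
    fillPos_succ]
  rcases h with ⟨h1, h2, h3⟩ | ⟨h1, h2, h3⟩
  · exact .inl ⟨by rwa [if_pos h3], h2, h3, trivial⟩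
  · have h4 := h1 _ le_rfl
    refine .inr ⟨fun l hl ↦ ?_, h2, by simp [h4], ?_⟩
    · obtain rfl | ⟨l, rfl⟩ := Fin.eq_self_or_eq_succAbove k.succ.castSucc l
      · exact fillLabel_self e k
      · have h5 := congr_fun (fillLabel_comp e k) l
        refine h5.trans (h1 _ ?_)
        by_contra! hj
        rw [Fin.succAbove_of_le_castSucc _ _ (by grind)] at hl
        grind
    · have : a k.castSucc ≤ a k.succ := ha k.castSucc_le_succ
      rw [if_neg (by simp [h4])]
      intro h6
      rw [h6] at this
      exact h3 ((Fin.le_zero_iff.1 this).trans h6.symm)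

lemma HasGap.reduced (he : Reduced e a) {k : Fin m} (h : HasGap e a k) :
    Reduced (fillLabel e k) (fillPos e a k) := by
  have h1 (l : Fin (m + 1)) : fillLabel e k (k.succ.castSucc.succAbove l) = e l :=
    congr_fun (fillLabel_comp e k) l
  have h2 (l : Fin (m + 1)) : fillPos e a k (k.succ.castSucc.succAbove l) = a l :=
    congr_fun (fillPos_comp e a k) l
  intro l
  obtain hl | rfl | rfl | hl : l < k.castSucc ∨ l = k.castSucc ∨ l = k.succ ∨ k.succ < l := by
    grind
  · obtain ⟨l, rfl⟩ := l.eq_castSucc_of_ne_last (by grind)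
    have h3 := Fin.succAbove_of_castSucc_lt k.succ.castSucc l.castSucc (by grind)
    have h4 := Fin.succAbove_of_castSucc_lt k.succ.castSucc l.succ (by grind)
    rw [Fin.succ_castSucc, ← h3, ← h4, h1, h1, h2, h2]
    exact he l
  · rw [Fin.succ_castSucc, fillLabel_castSucc, fillPos_castSucc, fillLabel_self, fillPos_self]
    rcases h with ⟨h3, h4, h5⟩ | ⟨h3, h4, h5⟩
    · simp [h5]
    · simpa [h3 _ le_rfl] using h5
  · rw [fillLabel_succ, fillPos_succ, fillLabel_self, fillPos_self]
    rcases h with ⟨h3, h4, h5⟩ | ⟨h3, h4, h5⟩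
    · rw [if_pos h5, h3]
      exact fun _ ↦ h4.symm
    · simp [h4]
  · obtain ⟨l, rfl⟩ := l.eq_succ_of_ne_zero (by grind)
    have h3 := Fin.succAbove_of_le_castSucc k.succ.castSucc l.castSucc (by grind)
    have h4 := Fin.succAbove_of_le_castSucc k.succ.castSucc l.succ (by grind)
    rw [← Fin.succ_castSucc, ← h3, ← h4, h1, h1, h2, h2]
    exact he l

/-- Look at the last vertex `r` over `0`. Label `true` gives a gap. Label `false` makes `r` a plug,
unless `r` is the initial vertex; then the first change of label from `false` to `true` decides,
being a gap or a plug according to whether the position changes there. -/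
lemma exists_hasGap_or_hasPlug {e : Fin (m + 2) → Bool} {a : Fin (m + 2) → Fin (n + 1)}
    (he : Reduced e a) (ha : Monotone a)
    (ha' : Function.Surjective a) (hn : n ≠ 0) (he' : ∃ l, e l = true) :
    (∃ k, HasGap e a k) ∨ ∃ k, HasPlug e a k := by
  obtain ⟨r, hr, hr'⟩ : ∃ r : Fin (m + 1), a r.castSucc = 0 ∧ a r.succ ≠ 0 := by
    obtain ⟨l, hl⟩ := ha' (Fin.last n)
    by_contra! h
    have (i : Fin (m + 2)) : a i = 0 := by
      induction i using Fin.induction with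
      | zero =>
        obtain ⟨l, hl⟩ := ha' 0
        exact Fin.le_zero_iff.1 (hl ▸ ha l.zero_le)
      | succ i hi => exact h _ hi
    rw [this] at hl
    exact hn (congr_arg Fin.val hl).symm
  cases hr2 : e r.castSucc
  swap
  · exact .inl ⟨r, .inl ⟨hr, hr', hr2⟩⟩
  obtain rfl | ⟨r, rfl⟩ := r.eq_zero_or_eq_succ
  · obtain ⟨s, hs, hs'⟩ : ∃ s : Fin (m + 1), (∀ l ≤ s.castSucc, e l = false) ∧ e s.succ = true := by
      by_contra! h
      have (i : Fin (m + 2)) : ∀ l ≤ i, e l = false := by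
        induction i using Fin.induction with
        | zero =>
          intro l hl
          obtain rfl := Fin.le_zero_iff.1 hl
          exact hr2
        | succ i hi =>
          intro l hl
          obtain rfl | hl := hl.eq_or_lt
          · simpa using h i hi
          · exact hi l (by grind)
      obtain ⟨l, hl⟩ := he'
      simp [this l l le_rfl] at hl
    by_cases h : a s.castSucc = a s.succ
    · obtain rfl | ⟨s, rfl⟩ := s.eq_zero_or_eq_succ
      · grind
      · refine .inr ⟨s, .inr ⟨hs, hs', h, fun h0 ↦ hr' ?_⟩⟩
        have := ha (show Fin.succ 0 ≤ s.succ.castSucc by grind)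
        rw [h0] at this
        exact Fin.le_zero_iff.1 this
    · exact .inl ⟨s, .inr ⟨hs, hs', h⟩⟩
  -- The preceding vertex also lies over `0`, so by reducedness its label is `true`.
  · refine .inr ⟨r, .inl ⟨hr, hr', ?_, hr2⟩⟩
    by_contra h
    simp only [Bool.not_eq_true] at h
    have h1 := ha (show r.castSucc.castSucc ≤ r.succ.castSucc by grind)
    rw [hr] at h1
    exact he r.castSucc (by rw [h, ← hr2]; rfl) ((Fin.le_zero_iff.1 h1).trans hr.symm)

end

/-- The rank which makes the pairing of walks regular. -/
lemma lt_of_hasGap_succAbove {e : Fin (m + 2) → Bool} {a : Fin (m + 2) → Fin (n + 1)}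
    (ha : Monotone a) {k : Fin m} (h : HasPlug e a k)
    {l : Fin (m + 2)} (hl : l ≠ k.succ.castSucc) {k' : Fin m}
    (h' : HasGap (e ∘ l.succAbove) (a ∘ l.succAbove) k') :
    a k.succ.castSucc <
      if e (l.succAbove k'.castSucc) then 0 else a (l.succAbove k'.succ) := by
  -- The plug survives in the face, as its vertex `i`.
  obtain ⟨i, hi⟩ := Fin.exists_succAbove_eq hl.symm
  have hmono := Fin.strictMono_succAbove l
  rcases h with ⟨h1, h2, h3, h4⟩ | ⟨h1, h2, h3, h4⟩ <;> rcases h' with ⟨h7, h8, h9⟩ | ⟨h7, h8, h9⟩ <;>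
    simp only [Function.comp_apply] at h7 h8 h9
  -- The plug would still be the last vertex over `0`, but its label is `false`.
  · exfalso
    have h10 : i ≤ k'.castSucc := by
      by_contra! hlt
      have := ha (hmono.monotone (show k'.succ ≤ i by grind))
      rw [hi, h1] at this
      exact h8 (Fin.le_zero_iff.1 this)
    have h11 : k'.castSucc ≤ i := by
      rw [← hmono.le_iff_le, hi]
      by_contra! hlt
      have := ha (show k.succ.succ ≤ _ from hlt)
      rw [h7] at this
      exact h2 (Fin.le_zero_iff.1 this)
    rw [le_antisymm h11 h10, hi, h4] at h9
    exact Bool.false_ne_true h9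
  · rw [if_neg (by simp [h7 _ le_rfl]), h1, Fin.pos_iff_ne_zero]
    intro h10
    have := ha (hmono.monotone k'.castSucc_le_succ)
    rw [h10] at this
    exact h9 ((Fin.le_zero_iff.1 this).trans h10.symm)
  -- A vertex labelled `true` comes after the plug, hence not over `0`.
  · exfalso
    by_cases h10 : l.succAbove k'.castSucc ≤ k.succ.castSucc
    · simp [h1 _ h10] at h9
    · have := ha (le_of_not_ge h10)
      rw [h7] at this
      exact h4 (Fin.le_zero_iff.1 this)
  · rw [if_neg (by simp [h7 _ le_rfl])]
    have h10 : i ≤ k'.castSucc := by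
      by_contra! hlt
      have := h1 _ (hi ▸ hmono.monotone (show k'.succ ≤ i by grind))
      simp [this] at h8
    exact (hi ▸ ha (hmono.monotone h10)).trans_lt
      (lt_of_le_of_ne (ha (hmono.monotone k'.castSucc_le_succ)) h9)

end SSet.isoCylinder

/-! ### The pairing on `coherentIso ⊗ Δ[n]` -/

namespace SSet.isoCylinder

open MonoidalCategory

variable {m n d : ℕ}

/-- The labels of the vertices of a simplex of `coherentIso ⊗ Δ[n]`. -/
def label (x : (coherentIso.{u} ⊗ Δ[n] : SSet.{u}) _⦋d⦌) (k : Fin (d + 1)) : Bool :=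
  (x.1.obj k).as.down

/-- The positions of the vertices of a simplex of `coherentIso ⊗ Δ[n]`. -/
def pos (x : (coherentIso.{u} ⊗ Δ[n] : SSet.{u}) _⦋d⦌) (k : Fin (d + 1)) : Fin (n + 1) :=
  x.2 k

lemma monotone_pos (x : (coherentIso.{u} ⊗ Δ[n] : SSet.{u}) _⦋d⦌) : Monotone (pos x) :=
  stdSimplex.monotone_apply x.2

lemma simplex_ext {x y : (coherentIso.{u} ⊗ Δ[n] : SSet.{u}) _⦋d⦌}
    (h₁ : label x = label y) (h₂ : pos x = pos y) : x = y := by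
  refine Prod.ext (Codiscrete.equivFun.injective ?_) (stdSimplex.ext _ _ (congr_fun h₂))
  ext k
  exact congr_fun h₁ k

/-- The simplex of `coherentIso ⊗ Δ[n]` with given labels and positions. -/
def mkSimplex (e : Fin (d + 1) → Bool) (a : Fin (d + 1) → Fin (n + 1)) (ha : Monotone a) :
    (coherentIso.{u} ⊗ Δ[n] : SSet.{u}) _⦋d⦌ :=
  ⟨Codiscrete.equivFun.symm (fun k ↦ ULift.up (e k)), stdSimplex.objMk ⟨a, ha⟩⟩

@[simp]
lemma label_mkSimplex (e : Fin (d + 1) → Bool) (a : Fin (d + 1) → Fin (n + 1)) (ha : Monotone a) :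
    label (mkSimplex.{u} e a ha) = e := rfl

@[simp]
lemma pos_mkSimplex (e : Fin (d + 1) → Bool) (a : Fin (d + 1) → Fin (n + 1)) (ha : Monotone a) :
    pos (mkSimplex.{u} e a ha) = a := rfl

lemma label_δ (x : (coherentIso.{u} ⊗ Δ[n] : SSet.{u}) _⦋d + 1⦌) (i : Fin (d + 2)) :
    label ((coherentIso ⊗ Δ[n] : SSet.{u}).δ i x) = label x ∘ i.succAbove := rfl

lemma pos_δ (x : (coherentIso.{u} ⊗ Δ[n] : SSet.{u}) _⦋d + 1⦌) (i : Fin (d + 2)) :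
    pos ((coherentIso ⊗ Δ[n] : SSet.{u}).δ i x) = pos x ∘ i.succAbove := rfl

lemma label_σ (x : (coherentIso.{u} ⊗ Δ[n] : SSet.{u}) _⦋d⦌) (i : Fin (d + 1)) :
    label ((coherentIso ⊗ Δ[n] : SSet.{u}).σ i x) = label x ∘ i.predAbove := rfl

lemma pos_σ (x : (coherentIso.{u} ⊗ Δ[n] : SSet.{u}) _⦋d⦌) (i : Fin (d + 1)) :
    pos ((coherentIso ⊗ Δ[n] : SSet.{u}).σ i x) = pos x ∘ i.predAbove := rfl

lemma mem_nonDegenerate_iff (x : (coherentIso.{u} ⊗ Δ[n] : SSet.{u}) _⦋d⦌) :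
    x ∈ (coherentIso ⊗ Δ[n] : SSet.{u}).nonDegenerate d ↔ Reduced (label x) (pos x) := by
  obtain _ | d := d
  · rw [nondegenerate_zero]
    exact ⟨fun _ k ↦ k.elim0, fun _ ↦ Set.mem_univ _⟩
  · rw [mem_nonDegenerate_iff_notMem_degenerate, degenerate_eq_iUnion_range_σ, Reduced]
    simp only [Set.mem_iUnion, Set.mem_range, not_exists]
    refine forall_congr' fun k ↦ ⟨fun h h₁ h₂ ↦ ?_, ?_⟩
    -- Deleting vertex `k + 1` and repeating vertex `k` changes nothing if the two vertices agree.
    · have key (i : Fin (d + 2)) :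
          k.succ.succAbove (k.predAbove i) = if i = k.succ then k.castSucc else i := by
        split_ifs with h
        · subst h
          simp
        · obtain hi | hi := lt_or_gt_of_ne h
          · rw [Fin.predAbove_of_le_castSucc _ _ (by grind),
              Fin.succAbove_of_castSucc_lt _ _ (by simpa)]
            simp
          · rw [Fin.predAbove_of_castSucc_lt _ _ (by grind),
              Fin.succAbove_of_le_castSucc _ _ (by grind)]
            simp
      refine h ((coherentIso ⊗ Δ[n] : SSet.{u}).δ k.succ x) (simplex_ext ?_ ?_)
      · ext i
        rw [label_σ, label_δ]
        simp only [Function.comp_apply, key]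
        split_ifs with h <;> simp [h, h₁]
      · ext i
        rw [pos_σ, pos_δ]
        simp only [Function.comp_apply, key]
        split_ifs with h <;> simp [h, h₂]
    · rintro h y rfl
      rw [label_σ, pos_σ] at h
      simp at h

/-- The endpoint `false` of `coherentIso`. -/
def endpoint : coherentIso.{u}.Subcomplex where
  obj _ := {x | ∀ k, (x.obj k).as.down = false}
  map _ _ hx _ := hx _

lemma notMem_unionProd_iff (x : (coherentIso.{u} ⊗ Δ[n] : SSet.{u}) _⦋d⦌) :
    x ∉ (endpoint.unionProd ∂Δ[n]).obj _ ↔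
      Function.Surjective (pos x) ∧ ∃ k, label x k = true := by
  refine (not_congr (Subcomplex.mem_unionProd_iff _ _ x)).trans (not_or.trans (and_congr ?_ ?_))
  · exact not_not
  · change (¬ ∀ k, label x k = false) ↔ _
    simp

variable (n) in
/-- The type (I) simplices of the pairing, together with the vertex to be deleted. -/
structure Plugged where
  /-- the dimension of the type (II) simplex -/
  dim : ℕ
  /-- the gap of the type (II) simplex -/
  gap : Fin dim
  /-- the type (I) simplex -/
  simplex : (coherentIso.{u} ⊗ Δ[n] : SSet.{u}) _⦋dim + 1⦌
  nonDegenerate : simplex ∈ (coherentIso ⊗ Δ[n] : SSet.{u}).nonDegenerate _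
  notMem : simplex ∉ (endpoint.unionProd ∂Δ[n]).obj _
  hasPlug : HasPlug (label simplex) (pos simplex) gap

namespace Plugged

lemma ext_of_mk_eq {s t : Plugged.{u} n} (h : S.mk s.simplex = S.mk t.simplex) : s = t := by
  obtain ⟨d, k, x, _, _, hx⟩ := s
  obtain ⟨d', k', x', _, _, hx'⟩ := t
  cases h
  obtain rfl := hx.unique (monotone_pos x) hx'
  rfl

variable (s : Plugged.{u} n)

/-- The deleted vertex. -/
def index : Fin (s.dim + 2) := s.gap.succ.castSucc

/-- The type (II) simplex. -/
def face : (coherentIso.{u} ⊗ Δ[n] : SSet.{u}) _⦋s.dim⦌ :=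
  (coherentIso ⊗ Δ[n] : SSet.{u}).δ s.index s.simplex

lemma reduced : Reduced (label s.simplex) (pos s.simplex) :=
  (mem_nonDegenerate_iff _).1 s.nonDegenerate

lemma hasGap : HasGap (label s.face) (pos s.face) s.gap :=
  s.hasPlug.hasGap s.reduced (monotone_pos _)

lemma pos_gap : pos s.simplex s.gap.succ.castSucc =
    if label s.face s.gap.castSucc then 0 else pos s.face s.gap.succ := by
  rw [s.hasPlug.apply_eq, face, label_δ, pos_δ, index]
  simp only [Function.comp_apply, succAbove_castSucc_self, succAbove_succ_self]

/-- A plug is determined by its neighbours. With uniqueness of gaps, this makes `face` injective. -/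
lemma simplex_eq : s.simplex = mkSimplex (fillLabel (label s.face) s.gap)
    (fillPos (label s.face) (pos s.face) s.gap) (monotone_fillPos (monotone_pos _) _) := by
  apply simplex_ext
  · ext i
    rw [label_mkSimplex]
    obtain rfl | ⟨i, rfl⟩ := Fin.eq_self_or_eq_succAbove s.gap.succ.castSucc i
    · rw [fillLabel_self, s.hasPlug.apply_eq_false]
    · exact (congr_fun (fillLabel_comp (label s.face) s.gap) i).symm
  · ext i
    rw [pos_mkSimplex]
    obtain rfl | ⟨i, rfl⟩ := Fin.eq_self_or_eq_succAbove s.gap.succ.castSucc i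
    · rw [fillPos_self, s.pos_gap]
      split_ifs with h
      · rcases s.hasGap with h' | h'
        · rw [h'.1]
        · simp [h'.1 _ le_rfl] at h
      · rfl
    · exact congr_arg Fin.val (congr_fun (fillPos_comp (label s.face) (pos s.face) s.gap) i).symm

lemma ext_of_mk_face_eq {s t : Plugged.{u} n} (h : S.mk s.face = S.mk t.face) : s = t := by
  apply ext_of_mk_eq
  rw [s.simplex_eq, t.simplex_eq]
  have hs := s.hasGap
  have ht := t.hasGap
  generalize s.face = x at *
  generalize t.face = y at *
  generalize s.gap = k at *
  generalize t.gap = k' at *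
  generalize s.dim = d at *
  generalize t.dim = d' at *
  cases h
  obtain rfl := hs.unique (monotone_pos x) ht
  rfl

lemma face_mem_nonDegenerate :
    s.face ∈ (coherentIso ⊗ Δ[n] : SSet.{u}).nonDegenerate _ := by
  rw [mem_nonDegenerate_iff]
  exact s.hasPlug.reduced_comp s.reduced (monotone_pos _)

lemma face_notMem : s.face ∉ (endpoint.unionProd ∂Δ[n]).obj _ := by
  have h := (notMem_unionProd_iff _).1 s.notMem
  exact (notMem_unionProd_iff _).2
    ⟨s.hasPlug.surjective_comp (monotone_pos _) h.1, s.hasPlug.exists_eq_true h.2⟩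

lemma mk_simplex_ne (t : Plugged.{u} n) : S.mk s.simplex ≠ S.mk t.face := by
  intro h
  obtain ⟨d, k, x, _, _, hx⟩ := s
  have ht := t.hasGap
  generalize t.face = y at *
  generalize t.gap = k' at *
  generalize t.dim = d' at *
  cases h
  exact hx.not_hasGap (monotone_pos x) _ ht

lemma exists_of_hasGap {x : (coherentIso.{u} ⊗ Δ[n] : SSet.{u}) _⦋d⦌}
    (hx : x ∈ (coherentIso ⊗ Δ[n] : SSet.{u}).nonDegenerate _)
    (hx' : x ∉ (endpoint.unionProd ∂Δ[n]).obj _) {k : Fin d}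
    (h : HasGap (label x) (pos x) k) :
    ∃ s : Plugged.{u} n, S.mk x = S.mk s.face := by
  rw [mem_nonDegenerate_iff] at hx
  have hx' := (notMem_unionProd_iff _).1 hx'
  let y : (coherentIso.{u} ⊗ Δ[n] : SSet.{u}) _⦋d + 1⦌ := mkSimplex (fillLabel (label x) k)
    (fillPos (label x) (pos x) k) (monotone_fillPos (monotone_pos _) _)
  have hy : (coherentIso ⊗ Δ[n] : SSet.{u}).δ k.succ.castSucc y = x := by
    apply simplex_ext
    · rw [label_δ, label_mkSimplex, fillLabel_comp]
    · rw [pos_δ, pos_mkSimplex, fillPos_comp]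
  refine ⟨{
    dim := d
    gap := k
    simplex := y
    nonDegenerate := (mem_nonDegenerate_iff _).2 (h.reduced hx)
    notMem := ?_
    hasPlug := h.hasPlug (monotone_pos x) }, congr_arg S.mk hy.symm⟩
  rw [← hy] at hx'
  refine (notMem_unionProd_iff _).2 ⟨fun i ↦ ?_, ?_⟩
  · obtain ⟨j, hj⟩ := hx'.1 i
    exact ⟨_, hj⟩
  · obtain ⟨j, hj⟩ := hx'.2
    exact ⟨_, hj⟩

lemma pos_lt {x : (coherentIso.{u} ⊗ Δ[n] : SSet.{u}) _⦋d⦌} {k : Fin d}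
    (hx : HasGap (label x) (pos x) k) (hd : d = s.dim) (f : ⦋d⦌ ⟶ ⦋s.dim + 1⦌) (_ : Mono f)
    (hf : (coherentIso ⊗ Δ[n] : SSet.{u}).map f.op s.simplex = x)
    (hne : S.mk x ≠ S.mk s.face) :
    pos s.simplex s.gap.succ.castSucc < if label x k.castSucc then 0 else pos x k.succ := by
  subst hd hf
  obtain ⟨l, rfl⟩ := SimplexCategory.eq_δ_of_mono f
  exact lt_of_hasGap_succAbove (monotone_pos _) s.hasPlug (by rintro rfl; exact hne rfl) hx

end Plugged

variable (n) in
/-- The pairing which shows that the pushout product of the inclusion of an endpoint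
of `coherentIso` with `∂Δ[n] ⟶ Δ[n]` is inner anodyne when `n ≠ 0`. -/
def pairingCore [NeZero n] :
    (endpoint.{u}.unionProd ∂Δ[n]).PairingCore where
  ι := Plugged.{u} n
  dim s := s.dim
  simplex s := s.simplex
  index s := s.index
  nonDegenerate₁ s := s.nonDegenerate
  nonDegenerate₂ s := s.face_mem_nonDegenerate
  notMem₁ s := s.notMem
  notMem₂ s := s.face_notMem
  injective_type₁' := Plugged.ext_of_mk_eq
  injective_type₂' := Plugged.ext_of_mk_face_eq
  type₁_ne_type₂' := Plugged.mk_simplex_ne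
  surjective' x := by
    obtain ⟨d, x, hx, hx', rfl⟩ := x.mk_surjective
    have h := (notMem_unionProd_iff _).1 hx'
    have h' := (mem_nonDegenerate_iff _).1 hx
    obtain _ | d := d
    -- One vertex cannot lie over both `0` and `n ≠ 0`.
    · obtain ⟨i, hi⟩ := h.1 0
      obtain ⟨j, hj⟩ := h.1 (Fin.last n)
      rw [Subsingleton.elim (α := Fin 1) j i, hi] at hj
      exact (NeZero.ne n (congr_arg Fin.val hj).symm).elim
    · obtain ⟨k, hk⟩ | ⟨k, hk⟩ :=
        exists_hasGap_or_hasPlug h' (monotone_pos x) h.1 (NeZero.ne n) h.2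
      · obtain ⟨s, hs⟩ := Plugged.exists_of_hasGap hx hx' hk
        exact ⟨s, .inr hs⟩
      · exact ⟨⟨d, k, x, hx, hx', hk⟩, .inl rfl⟩

instance [NeZero n] : (pairingCore.{u} n).IsProper where
  isUniquelyCodimOneFace (s : Plugged n) := by
    refine (S.IsUniquelyCodimOneFace.iff _ _).2 ⟨s.index, rfl, fun i hi ↦ ?_⟩
    have hi : (coherentIso ⊗ Δ[n] : SSet.{u}).δ i s.simplex = s.face := hi
    exact s.reduced.succAbove_injective (congr_arg label hi) (congr_arg pos hi)

instance [NeZero n] : (pairingCore.{u} n).IsInner where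
  ne_zero (s : Plugged n) := (Fin.castSucc_ne_zero_iff.2 s.gap.succ_ne_zero :)
  ne_last _ := (Fin.castSucc_lt_last _).ne

instance [NeZero n] : (pairingCore.{u} n).IsRegular where
  wf := by
    -- In equal dimension, a face with a gap other than the paired one is filled at a strictly
    -- larger position than the plug; positions are bounded by `n`.
    refine Subrelation.wf (r := InvImage (Prod.Lex (· < ·) (· < ·))
      (fun s : Plugged.{u} n ↦ (s.dim, n - (pos s.simplex s.gap.succ.castSucc).val))) ?_
      (InvImage.wf _ (WellFounded.prod_lex wellFounded_lt wellFounded_lt))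
    rintro (s : Plugged n) (t : Plugged n) ⟨h₁, h₂⟩
    have h₃ : s.dim < t.dim + 1 := SSet.N.dim_lt_of_lt h₂
    obtain ⟨f, hf', hf⟩ := SSet.N.le_iff_exists_mono.1 h₂.le
    rw [InvImage, Prod.lex_iff]
    obtain h₄ | h₄ := (Nat.lt_succ_iff.1 h₃).lt_or_eq
    · exact .inl h₄
    · refine .inr ⟨h₄, ?_⟩
      have h₅ := t.pos_lt s.hasGap h₄ f hf' hf fun h ↦ h₁ (Plugged.ext_of_mk_face_eq h)
      rw [← s.pos_gap, Fin.lt_def] at h₅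
      dsimp only
      omega

lemma innerAnodyneExtensions_endpoint_unionProd_boundary [NeZero n] :
    innerAnodyneExtensions (endpoint.{u}.unionProd ∂Δ[n]).ι :=
  (pairingCore.{u} n).pairing.innerAnodyneExtensions

end SSet.isoCylinder

/-! ### Extension of homotopies and right cancellation -/

namespace SSet

open MonoidalCategory CartesianMonoidalCategory MonoidalClosed Limits HomotopicalAlgebra

/-- If `q` has the right lifting property with respect to `∂Δ[n] ⟶ Δ[n]` for all `n ≠ 0`, then
a lifting problem for `q` and a monomorphism has a solution as soon as its bottom
map lifts to the source of `q`, possibly in a way which is incompatible with the top map. -/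
lemma exists_lift_of_hasLiftingProperty_boundary {E D B C : SSet.{u}} (q : E ⟶ D)
    (hq : ∀ (n : ℕ) [NeZero n], HasLiftingProperty ∂Δ[n].ι q)
    (j : B ⟶ C) [Mono j] (f : B ⟶ E) (g : C ⟶ E) (w : f ≫ q = j ≫ g ≫ q) :
    ∃ l : C ⟶ E, j ≫ l = f ∧ l ≫ q = g ≫ q := by
  have hπ : (monomorphisms SSet.{u}).rlp (pullback.snd q (g ≫ q)) := by
    rw [rlp_monomorphisms]
    rintro _ _ _ ⟨n⟩
    obtain _ | n := n
    -- `∂Δ[0]` is empty, so the section of the pullback induced by `g` gives the lift.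
    · refine ⟨fun {a b} sq ↦ ⟨⟨⟨b ≫ pullback.lift g (𝟙 C) (Category.id_comp _).symm, ?_, ?_⟩⟩⟩⟩
      · ext
      · rw [Category.assoc, pullback.lift_snd, Category.comp_id]
    · have := hq (n + 1)
      exact (IsPullback.of_hasPullback q (g ≫ q)).hasLiftingProperty _
  have := hπ j (.infer_property _)
  have sq : CommSq (pullback.lift f j w) j (pullback.snd q (g ≫ q)) (𝟙 C) :=
    ⟨(pullback.lift_snd _ _ _).trans (Category.comp_id _).symm⟩
  refine ⟨sq.lift ≫ pullback.fst _ _, ?_, ?_⟩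
  · rw [sq.fac_left_assoc, pullback.lift_fst]
  · rw [Category.assoc, pullback.condition, sq.fac_right_assoc, Category.id_comp]

namespace isoCylinder

lemma hasLiftingProperty_boundary_pullbackObjObj {X Y : SSet.{u}} (p : X ⟶ Y) [InnerFibration p]
    (sq : internalHom.PullbackObjObj endpoint.{u}.ι p) (n : ℕ) [NeZero n] :
    HasLiftingProperty ∂Δ[n].ι sq.π := by
  rw [← internalHomAdjunction₂.hasLiftingProperty_iff
    (Subcomplex.unionProd.pushoutObjObj.{u} _ _), Subcomplex.unionProd.pushoutObjObj_ι]
  exact innerAnodyneExtensions_endpoint_unionProd_boundary _ (by rwa [← innerFibration_iff])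

/-- The constant simplices of `coherentIso`. -/
def endpoints : coherentIso.{u}.Subcomplex where
  obj _ := {x | ∀ k l, (x.obj k).as.down = (x.obj l).as.down}
  map _ _ hx _ _ := hx _ _

/-- The morphism `endpoints ⊗ B ⟶ X` which is `f` on one endpoint and `g` on the other. -/
noncomputable def endpointsDesc {B X : SSet.{u}} (f g : B ⟶ X) :
    (endpoints.{u} : SSet) ⊗ B ⟶ X where
  app d := ↾fun x ↦ if (x.1.1.obj 0).as.down then g.app d x.2 else f.app d x.2
  naturality := by
    intro d d' φ
    ext x
    obtain ⟨⟨e, he⟩, b⟩ := x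
    change ite ((e.obj _).as.down = true) _ _ = X.map φ (ite ((e.obj _).as.down = true) _ _)
    -- The label is constant along the simplex, so reading it at vertex `0` is natural.
    rw [he _ 0]
    split_ifs
    · exact NatTrans.naturality_apply g φ b
    · exact NatTrans.naturality_apply f φ b

lemma endpointsDesc_app {B X : SSet.{u}} (f g : B ⟶ X) {d : SimplexCategoryᵒᵖ}
    (e : (endpoints.{u} : SSet).obj d) (b : B.obj d) :
    (endpointsDesc f g).app d (⟨e, b⟩ : ((endpoints.{u} : SSet.{u}) ⊗ B).obj d) =
      if (e.1.obj 0).as.down then g.app d b else f.app d b := rfl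

/-- The pushout product of `endpoints.ι` with `i` is again inner anodyne. The lifting problem
prescribes `f` and `g` at the ends and the constant homotopy on `A`. -/
lemma exists_homotopy {A B X Y : SSet.{u}} {i : A ⟶ B} (hi : innerAnodyneExtensions i)
    (p : X ⟶ Y) [InnerFibration p] (f g : B ⟶ X) (h : i ≫ f = i ≫ g) (h' : f ≫ p = g ≫ p) :
    ∃ H : coherentIso ⊗ B ⟶ X, endpoints.ι ▷ B ≫ H = endpointsDesc f g ∧
      H ≫ p = snd _ _ ≫ f ≫ p := by
  let sq := Functor.PushoutObjObj.ofHasPushout (curriedTensor SSet) endpoints.ι i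
  have := innerAnodyneExtensions_pushoutObjObjι sq hi p (by rwa [← innerFibration_iff])
  have w : endpoints.ι ▷ A ≫ snd coherentIso A ≫ i ≫ f =
      (endpoints : SSet) ◁ i ≫ endpointsDesc f g := by
    ext d ⟨e, a⟩
    refine Eq.trans ?_ (endpointsDesc_app f g e (i.app d a)).symm
    rw [show g.app d (i.app d a) = f.app d (i.app d a) from
      ConcreteCategory.congr_hom (NatTrans.congr_app h.symm d) a, ite_self]
    rfl
  have w' : CommSq (sq.isPushout.desc (snd coherentIso A ≫ i ≫ f) (endpointsDesc f g) w)
      sq.ι p (snd coherentIso B ≫ f ≫ p) := ⟨by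
    apply sq.isPushout.hom_ext
    · rw [sq.isPushout.inl_desc_assoc, sq.inl_ι_assoc]
      rfl
    · rw [sq.isPushout.inr_desc_assoc, sq.inr_ι_assoc]
      ext d ⟨e, b⟩
      refine (congr_arg (p.app d) (endpointsDesc_app f g e b)).trans ?_
      split_ifs
      · exact ConcreteCategory.congr_hom (NatTrans.congr_app h'.symm d) b
      · rfl⟩
  refine ⟨w'.lift, ?_, w'.fac_right⟩
  have := sq.inr ≫= w'.fac_left
  rw [sq.inr_ι_assoc, sq.isPushout.inr_desc] at this
  exact this

/-- By adjunction this is a lifting problem for `j` and the pullback-hom of `endpoint.ι` and `p`.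
The constant homotopy at `t` lifts its bottom map, so the boundaries with `n ≠ 0` suffice. -/
lemma exists_extension {B C X Y : SSet.{u}} (j : B ⟶ C) [Mono j] (p : X ⟶ Y) [InnerFibration p]
    (H : coherentIso ⊗ B ⟶ X) (t : C ⟶ X) (h : endpoint.ι ▷ B ≫ H = snd _ _ ≫ j ≫ t)
    (h' : H ≫ p = snd _ _ ≫ j ≫ t ≫ p) :
    ∃ K : coherentIso ⊗ C ⟶ X, coherentIso ◁ j ≫ K = H ∧ K ≫ p = snd _ _ ≫ t ≫ p := by
  let sq := Functor.PullbackObjObj.ofHasPullback internalHom endpoint.{u}.ι p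
  let adj := internalHomAdjunction₂ (C := SSet.{u})
  obtain ⟨l, hl, hl'⟩ := exists_lift_of_hasLiftingProperty_boundary sq.π
    (fun _ _ ↦ hasLiftingProperty_boundary_pullbackObjObj p sq _) j
    (adj.homEquiv (X₁ := coherentIso) (X₂ := B) (X₃ := X) H)
    (adj.homEquiv (X₁ := coherentIso) (X₂ := C) (X₃ := X) (snd _ _ ≫ t)) (by
      apply sq.isPullback.hom_ext
      · simp only [Category.assoc, sq.π_fst]
        rw [← adj.homEquiv_naturality_one, ← adj.homEquiv_naturality_one,
          ← adj.homEquiv_naturality_two]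
        exact congr_arg _ h
      · simp only [Category.assoc, sq.π_snd]
        rw [← adj.homEquiv_naturality_three, ← adj.homEquiv_naturality_three,
          ← adj.homEquiv_naturality_two]
        exact congr_arg _ h')
  obtain ⟨K, rfl⟩ := (adj.homEquiv (X₁ := coherentIso) (X₂ := C) (X₃ := X)).surjective l
  refine ⟨K, ?_, ?_⟩
  · rw [← adj.homEquiv_naturality_two] at hl
    exact adj.homEquiv.injective hl
  · have := hl' =≫ sq.snd
    simp only [Category.assoc, sq.π_snd] at this
    rw [← adj.homEquiv_naturality_three, ← adj.homEquiv_naturality_three] at this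
    exact adj.homEquiv.injective this

end isoCylinder

open isoCylinder in
/-- Inner anodyne extensions have the right cancellation property. -/
lemma rightCancellation_innerAnodyneExtensions :
    RightCancellation innerAnodyneExtensions.{u} := by
  intro A B C i j _ _ hi hij X Y p hp
  have : InnerFibration p := by rwa [innerFibration_iff]
  refine ⟨fun {f v} sq ↦ ?_⟩
  have := hij p hp
  have sq' : CommSq (i ≫ f) (i ≫ j) p v := ⟨by simp [sq.w]⟩
  obtain ⟨H, hH, hH'⟩ := exists_homotopy hi p (j ≫ sq'.lift) f sq'.fac_left
    (by rw [Category.assoc, sq'.fac_right, sq.w])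
  have hH₂ {d : SimplexCategoryᵒᵖ} (e : (endpoints.{u} : SSet).obj d) (b : B.obj d) :
      H.app d (⟨e.1, b⟩ : (coherentIso ⊗ B : SSet.{u}).obj d) =
        if (e.1.obj 0).as.down then f.app d b else (j ≫ sq'.lift).app d b :=
    ConcreteCategory.congr_hom (NatTrans.congr_app hH d)
      (⟨e, b⟩ : ((endpoints.{u} : SSet.{u}) ⊗ B).obj d)
  obtain ⟨K, hK, hK'⟩ := exists_extension j p H sq'.lift (by
    ext d ⟨e, b⟩
    exact (hH₂ ⟨e.1, fun k l ↦ (e.2 k).trans (e.2 l).symm⟩ b).trans (if_neg (by simp [e.2 0])))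
    (by simpa using hH')
  -- At the end labelled `true`, the homotopy restricts to `f` on `B`.
  refine ⟨⟨⟨lift (const coherentIso.x₁) (𝟙 C) ≫ K, ?_, ?_⟩⟩⟩
  · change lift (const coherentIso.x₁) (𝟙 B) ≫ coherentIso ◁ j ≫ K = f
    rw [hK]
    ext d b
    exact (hH₂ ⟨(const (X := B) coherentIso.x₁).app d b, fun _ _ ↦ rfl⟩ b).trans (if_pos rfl)
  · rw [Category.assoc, hK', lift_snd_assoc, Category.id_comp, sq'.fac_right]

end SSet

theorem theoremE : SSet.RightCancellation SSet.innerAnodyneExtensions.{u} :=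
  SSet.rightCancellation_innerAnodyneExtensions
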